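/- Let $d$ be a positive integer, let $A,B\in\mathbb R^{d\times d}$ and $\Sigma\in\mathbb R^{2d\times 2d}$ be symmetric positive-definite matrices, and let $\varepsilon>0$. Write $\mu=N_d(A)$, $\nu=N_d(B)$ and $N_{2d}(\Sigma)$ for the centered Gaussian measures on $\mathbb R^d$, $\mathbb R^d$ and $\mathbb R^d\times\mathbb R^d$ with covariance matrices $A$, $B$ and $\Sigma$. Let $\Pi(\mu,\nu)$ be the set of measures on $\mathbb R^d\times\mathbb R^d$ with marginals $\mu$ and $\nu$, and let $$W_\Sigma^\varepsilon(\mu,\nu)=\inf_{\pi\in\Pi(\mu,\nu)}\left\{\int_{\mathbb R^d\times\mathbb R^d}\|x-y\|^2\,d\pi(x,y)+2\varepsilon\,\mathrm{KL}\bigl(\pi\,|\,N_{2d}(\Sigma)\bigr)\right\},$$ where $\mathrm{KL}(\pi|\rho)=\int\log\frac{d\pi}{d\rho}\,d\pi$ if $\pi\ll\rho$ and $\mathrm{KL}(\pi|\rho)=+\infty$ otherwise. For $C\in\mathbb R^{d\times d}$ put $$X_C=\begin{pmatrix}A&C\\ C^T&B\end{pmatrix},\qquad Y=\begin{pmatrix}I_d&-I_d\\-I_d&I_d\end{pmatrix},\qquad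 \Pi^+(A,B)=\{C\in\mathbb R^{d\times d}: X_C\ \text{is positive semidefinite}\},$$ and $\langle M,N\rangle_{\mathrm{HS}}=\operatorname{tr}(MN^T)$, with the convention $-\log\det X_C=+\infty$ when $X_C$ is positive semidefinite but singular. Then the infimum defining $W_\Sigma^\varepsilon(\mu,\nu)$ is attained, the minimum below is attained and finite, and $$W_\Sigma^\varepsilon(\mu,\nu)=\min_{C\in\Pi^+(A,B)}\Bigl\{\bigl\langle Y+\varepsilon\Sigma^{-1},X_C\bigr\rangle_{\mathrm{HS}}-\varepsilon\log\det X_C\Bigr\}+\varepsilon\log\det\Sigma-2\varepsilon d .$$ -/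

import Mathlib

open MeasureTheory ProbabilityTheory InformationTheory
open scoped ENNReal Matrix

noncomputable section

namespace GaussianEOT

/-- `ℝ^d` with its Euclidean norm. -/
abbrev Rd (d : ℕ) : Type := EuclideanSpace ℝ (Fin d)

/-- Real `2d × 2d` matrices, written in `d × d` blocks. -/
abbrev BlockMat (d : ℕ) : Type := Matrix (Fin d ⊕ Fin d) (Fin d ⊕ Fin d) ℝ

/-- The centered Gaussian measure `N_d(A)` on `ℝ^d` with covariance matrix `A`. -/
def gaussian {d : ℕ} (A : Matrix (Fin d) (Fin d) ℝ) : Measure (Rd d) :=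
  multivariateGaussian 0 A

/-- The centered Gaussian measure `N_{2d}(S)` with covariance matrix `S`, as a measure on
`ℝ^d × ℝ^d` (first block of coordinates, second block of coordinates). -/
def jointGaussian {d : ℕ} (S : BlockMat d) : Measure (Rd d × Rd d) :=
  (multivariateGaussian (0 : EuclideanSpace ℝ (Fin d ⊕ Fin d)) S).map
    (EuclideanSpace.sumEquivProd (𝕜 := ℝ) (ι := Fin d) (κ := Fin d))

/-- The set `Π(μ, ν)` of couplings of `μ` and `ν`. -/
def couplings {d : ℕ} (μ ν : Measure (Rd d)) : Set (Measure (Rd d × Rd d)) :=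
  {π | π.map Prod.fst = μ ∧ π.map Prod.snd = ν}

/-- The objective `∫ ‖x - y‖² dπ(x, y) + 2 ε KL(π | N_{2d}(S))`, with values in `[0, ∞]`. -/
def transportObjective {d : ℕ} (S : BlockMat d) (ε : ℝ) (π : Measure (Rd d × Rd d)) : ℝ≥0∞ :=
  ∫⁻ z, ENNReal.ofReal (‖z.1 - z.2‖ ^ 2) ∂π
    + ENNReal.ofReal (2 * ε) * klDiv π (jointGaussian S)

/-- The value `W_S^ε(μ, ν)` of the regularized optimal transport problem. -/
def entropicOT {d : ℕ} (S : BlockMat d) (ε : ℝ) (μ ν : Measure (Rd d)) : ℝ≥0∞ :=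
  ⨅ π ∈ couplings μ ν, transportObjective S ε π

/-- `X_C`, the block matrix with rows `(A, C)` and `(Cᵀ, B)`. -/
def covOfCross {d : ℕ} (A B C : Matrix (Fin d) (Fin d) ℝ) : BlockMat d :=
  Matrix.fromBlocks A C Cᵀ B

/-- The set `Π⁺(A, B)` of admissible cross-covariance matrices. -/
def admissibleCross {d : ℕ} (A B : Matrix (Fin d) (Fin d) ℝ) :
    Set (Matrix (Fin d) (Fin d) ℝ) :=
  {C | (covOfCross A B C).PosSemidef}

/-- The optimal transport matrix `Y`, with rows of blocks `(I, -I)` and `(-I, I)`. -/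
def otMatrix (d : ℕ) : BlockMat d :=
  Matrix.fromBlocks 1 (-1) (-1) 1

/-- The Hilbert-Schmidt inner product `tr (M Nᵀ)`. -/
def hsInner {d : ℕ} (M N : BlockMat d) : ℝ :=
  (M * Nᵀ).trace

open scoped Classical in
/-- The extended function `X ↦ -log det X`, equal to `+∞` where `X` is not positive definite. -/
def negLogDet {d : ℕ} (X : BlockMat d) : EReal :=
  if X.PosDef then ((-Real.log X.det : ℝ) : EReal) else ⊤

/-- The matrix objective `⟨Y + ε S⁻¹, X_C⟩ - ε log det X_C`, with values in `(-∞, ∞]`. -/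
def matrixObjective {d : ℕ} (A B : Matrix (Fin d) (Fin d) ℝ) (S : BlockMat d) (ε : ℝ)
    (C : Matrix (Fin d) (Fin d) ℝ) : EReal :=
  ((hsInner (otMatrix d + ε • S⁻¹) (covOfCross A B C) : ℝ) : EReal)
    + (ε : EReal) * negLogDet (covOfCross A B C)

end GaussianEOT

end

namespace GaussianEOT

open Filter Topology

/-! ### The finite-dimensional matrix problem -/

section MatrixProblem

variable {d : ℕ}

/-! Put `W = Y + ε S⁻¹`. The function `exp(-⟨W, X_C⟩ / ε) det X_C` is continuous on the compact set
of admissible `C`, vanishes where `X_C` is singular and is positive at `C = 0`. So it has a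
maximizer with `X = X_C` positive definite, which minimizes the matrix objective. Stationarity says
that `W - ε X⁻¹` is orthogonal to every off-diagonal perturbation, hence is block diagonal
(`exists_minimizer_blockDiag`).

For a coupling `π` with finite entropy, changing the reference from `N(S)` to `N(X)` adds to the
entropy the integral of a quadratic form and a log-determinant (`klDiv_jointGaussian_change`).
Together with the transport cost, the quadratic form becomes exactly `W - ε X⁻¹`; being block
diagonal, its integral depends only on the marginals. Therefore the objective at `π` is a constant
plus `2 ε KL(π | N(X))` (`cost_add_klDiv_eq`). It is minimized at `π = N(X)`, and the constant is
the claimed value. -/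

theorem covOfCross_add_smul (A B C E : Matrix (Fin d) (Fin d) ℝ) (t : ℝ) :
    covOfCross A B (C + t • E) = covOfCross A B C + t • Matrix.fromBlocks 0 E Eᵀ 0 := by
  simp [covOfCross, Matrix.fromBlocks_smul, Matrix.fromBlocks_add]

theorem continuous_covOfCross (A B : Matrix (Fin d) (Fin d) ℝ) :
    Continuous (covOfCross A B) :=
  continuous_const.matrix_fromBlocks continuous_id continuous_id.matrix_transpose continuous_const

theorem posDef_covOfCross_zero {A B : Matrix (Fin d) (Fin d) ℝ} (hA : A.PosDef) (hB : B.PosDef) :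
    (covOfCross A B 0).PosDef := by
  have : Invertible A := hA.isUnit.invertible
  have hpsd : (covOfCross A B 0).PosSemidef := by
    have := (hA.fromBlocks₁₁ 0 B).2 (by simpa using hB.posSemidef)
    simpa [covOfCross] using this
  rw [hpsd.posDef_iff_det_ne_zero, covOfCross, Matrix.transpose_zero, Matrix.det_fromBlocks_zero₁₂]
  exact (mul_pos hA.det_pos hB.det_pos).ne'

theorem isClosed_setOf_posSemidef {n : Type*} [Fintype n] :
    IsClosed {M : Matrix n n ℝ | M.PosSemidef} := by
  simp only [Matrix.posSemidef_iff_dotProduct_mulVec, Set.ofPred_and, Set.ofPred_forall]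
  refine IsClosed.inter (isClosed_eq (by fun_prop) continuous_id) (isClosed_iInter fun x => ?_)
  exact isClosed_le continuous_const (by fun_prop)

/-- Evaluate the quadratic form at `e_i ± e_j`, with `e_i` in the first block and `e_j` in the
second. -/
theorem abs_le_of_mem_admissibleCross {A B C : Matrix (Fin d) (Fin d) ℝ}
    (hC : C ∈ admissibleCross A B) (i j : Fin d) : |C i j| ≤ (A i i + B j j) / 2 := by
  have h (s : ℝ) := hC.dotProduct_mulVec_nonneg
    (Pi.single (Sum.inl i) 1 + Pi.single (Sum.inr j) s)
  have h1 := h 1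
  have h2 := h (-1)
  simp [covOfCross, Matrix.mulVec_add, add_dotProduct, dotProduct_add] at h1 h2
  rw [abs_le]
  constructor <;> linarith

theorem isCompact_admissibleCross (A B : Matrix (Fin d) (Fin d) ℝ) :
    IsCompact (admissibleCross A B) := by
  refine IsCompact.of_isClosed_subset (s := Set.univ.pi fun i => Set.univ.pi fun j =>
    Set.Icc (-((A i i + B j j) / 2)) ((A i i + B j j) / 2)) ?_ ?_ ?_
  · exact isCompact_univ_pi fun i => isCompact_univ_pi fun j => isCompact_Icc
  · exact isClosed_setOf_posSemidef.preimage (continuous_covOfCross A B)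
  · intro C hC i _ j _
    exact abs_le.1 (abs_le_of_mem_admissibleCross hC i j)

theorem continuous_hsInner (M : BlockMat d) : Continuous (hsInner M) := by
  unfold hsInner
  fun_prop

theorem hsInner_add_smul (M N H : BlockMat d) (t : ℝ) :
    hsInner M (N + t • H) = hsInner M N + t * hsInner M H := by
  simp [hsInner, Matrix.mul_add]

open scoped MatrixOrder in
theorem exists_algebraMap_le {n : Type*} [Fintype n] [DecidableEq n] {H : Matrix n n ℝ}
    (hH : H.IsHermitian) : ∃ K : ℝ, 0 ≤ K ∧ algebraMap ℝ (Matrix n n ℝ) (-K) ≤ H := by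
  obtain ⟨m, hm⟩ := (Matrix.finite_real_spectrum (A := H)).bddBelow
  refine ⟨|m|, abs_nonneg m, (algebraMap_le_iff_le_spectrum (a := H)
    (ha := hH.isSelfAdjoint)).2 fun x hx => ?_⟩
  exact (neg_abs_le m).trans (hm hx)

-- If `X ≥ r > 0` and `H ≥ -K`, then `X + |t| H ≥ r - |t| K`, which is nonnegative for small `t`.
-- Applying this to both `H` and `-H` covers both signs of `t`.
open scoped MatrixOrder in
theorem eventually_posSemidef_add_smul {n : Type*} [Fintype n] [DecidableEq n]
    {X H : Matrix n n ℝ} (hX : X.PosDef) (hH : H.IsHermitian) :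
    ∀ᶠ t in 𝓝 (0 : ℝ), (X + t • H).PosSemidef := by
  cases isEmpty_or_nonempty n
  · exact .of_forall fun t => Subsingleton.elim X (X + t • H) ▸ hX.posSemidef
  obtain ⟨r, hr, hrX⟩ := (CFC.exists_pos_algebraMap_le_iff hX.isHermitian.isSelfAdjoint).2
    (fun x hx => (Matrix.isStrictlyPositive_iff_posDef.2 hX).spectrum_pos hx)
  have key {H : Matrix n n ℝ} (hH : H.IsHermitian) :
      ∀ᶠ t in 𝓝 (0 : ℝ), (X + |t| • H).PosSemidef := by
    obtain ⟨K, hK, hKH⟩ := exists_algebraMap_le hH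
    have hev : ∀ᶠ t in 𝓝 (0 : ℝ), |t| * K < r := by
      have : Tendsto (fun t : ℝ => |t| * K) (𝓝 0) (𝓝 (|(0 : ℝ)| * K)) :=
        Continuous.tendsto (by fun_prop) 0
      rw [abs_zero, zero_mul] at this
      exact this.eventually_lt_const hr
    filter_upwards [hev] with t ht
    have h1 := (Matrix.le_iff.1 hKH).smul (abs_nonneg t)
    have h2 : ((r - |t| * K) • (1 : Matrix n n ℝ)).PosSemidef :=
      Matrix.PosSemidef.one.smul (sub_nonneg.2 ht.le)
    have h3 := ((Matrix.le_iff.1 hrX).add h1).add h2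
    convert! h3 using 1
    rw [Algebra.algebraMap_eq_smul_one, Algebra.algebraMap_eq_smul_one]
    module
  filter_upwards [key hH, key hH.neg] with t h1 h2
  rcases abs_choice t with h | h
  · rwa [h] at h1
  · rwa [h, smul_neg, neg_smul, neg_neg] at h2

/-- The determinant is `1 + t tr M + t² p(t)` for a polynomial `p`. -/
theorem hasDerivAt_det_one_add_smul {n : Type*} [Fintype n] [DecidableEq n]
    (M : Matrix n n ℝ) : HasDerivAt (fun t : ℝ => (1 + t • M).det) M.trace 0 := by
  rw [funext fun t : ℝ => Matrix.det_one_add_smul t M]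
  set p := (Matrix.det (1 + (Polynomial.X : Polynomial ℝ) • M.map Polynomial.C)).divX.divX
  have h := (((hasDerivAt_id (0 : ℝ)).const_mul M.trace).const_add 1).add
    ((p.hasDerivAt 0).mul ((hasDerivAt_id (0 : ℝ)).pow 2))
  convert! h using 1
  simp

/-- Exponential form of the negative of the matrix objective, divided by `ε`. -/
noncomputable def expObjective (W : BlockMat d) (ε : ℝ) (X : BlockMat d) : ℝ :=
  Real.exp (-hsInner W X / ε) * X.det

/-- First-order condition: positive definiteness keeps `C + t E` admissible for small `t` of either
sign, so the derivative along `E` vanishes. -/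
theorem trace_eq_of_isMaxOn {A B C : Matrix (Fin d) (Fin d) ℝ} {W : BlockMat d} {ε : ℝ}
    (hX : (covOfCross A B C).PosDef)
    (hmax : IsMaxOn (fun C => expObjective W ε (covOfCross A B C)) (admissibleCross A B) C)
    (E : Matrix (Fin d) (Fin d) ℝ) :
    hsInner W (Matrix.fromBlocks 0 E Eᵀ 0) / ε =
      ((covOfCross A B C)⁻¹ * Matrix.fromBlocks 0 E Eᵀ 0).trace := by
  set X := covOfCross A B C with hXdef
  set H : BlockMat d := Matrix.fromBlocks 0 E Eᵀ 0 with hHdef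
  have hH : H.IsHermitian := by
    rw [hHdef, Matrix.IsHermitian, Matrix.fromBlocks_conjTranspose]; simp
  have hfac (t : ℝ) : X + t • H = X * (1 + t • (X⁻¹ * H)) := by
    rw [mul_add, mul_one, Matrix.mul_smul, Matrix.mul_nonsing_inv_cancel_left _ _
      ((Matrix.isUnit_iff_isUnit_det _).1 hX.isUnit)]
  have hloc : IsLocalMax (fun t : ℝ => expObjective W ε (X + t • H)) 0 := by
    filter_upwards [eventually_posSemidef_add_smul hX hH] with t ht
    rw [hXdef, ← covOfCross_add_smul] at ht ⊢
    have := hmax (show C + t • E ∈ admissibleCross A B from ht)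
    simpa [← covOfCross_add_smul] using this
  have hderiv : HasDerivAt (fun t : ℝ => expObjective W ε (X + t • H))
      (expObjective W ε X * (-(hsInner W H / ε) + (X⁻¹ * H).trace)) 0 := by
    have h1 : HasDerivAt (fun t : ℝ => Real.exp (-(hsInner W X + t * hsInner W H) / ε))
        (Real.exp (-hsInner W X / ε) * (-(hsInner W H) / ε)) 0 := by
      have := (((((hasDerivAt_id (0 : ℝ)).mul_const (hsInner W H)).const_add
        (hsInner W X)).neg).div_const ε).exp
      simpa using this
    have h2 := h1.mul ((hasDerivAt_det_one_add_smul (X⁻¹ * H)).const_mul X.det)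
    convert! h2 using 1
    · ext t
      rw [Pi.mul_apply, expObjective, hsInner_add_smul, hfac t, Matrix.det_mul]
    · simp [expObjective]; ring
  have h0 := hloc.hasDerivAt_eq_zero hderiv
  have hpos : expObjective W ε X ≠ 0 := (mul_pos (Real.exp_pos _) hX.det_pos).ne'
  have := (mul_eq_zero.1 h0).resolve_left hpos
  linarith

theorem trace_fromBlocks {m n : Type*} [Fintype m] [Fintype n] (A : Matrix m m ℝ)
    (B : Matrix m n ℝ) (C : Matrix n m ℝ) (D : Matrix n n ℝ) :
    (Matrix.fromBlocks A B C D).trace = A.trace + D.trace := by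
  simp [Matrix.trace]

theorem fromBlocks_offDiag_eq_zero {G : BlockMat d} (hG : Gᵀ = G)
    (h : ∀ E : Matrix (Fin d) (Fin d) ℝ, (G * Matrix.fromBlocks 0 E Eᵀ 0).trace = 0) :
    G = Matrix.fromBlocks G.toBlocks₁₁ 0 0 G.toBlocks₂₂ := by
  have h21 : G.toBlocks₂₁ = (G.toBlocks₁₂)ᵀ := by
    ext i j
    exact congrFun₂ hG.symm (Sum.inr i) (Sum.inl j)
  have h12 : G.toBlocks₁₂ = 0 := by
    -- Testing against the off-diagonal block itself gives twice its squared Hilbert-Schmidt norm.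
    have := h G.toBlocks₁₂
    rw [← Matrix.fromBlocks_toBlocks G, Matrix.fromBlocks_multiply, trace_fromBlocks] at this
    simp only [Matrix.toBlocks_fromBlocks₁₂, h21, Matrix.mul_zero, zero_add, add_zero] at this
    rw [Matrix.trace_mul_comm (G.toBlocks₁₂)ᵀ] at this
    rw [← Matrix.trace_mul_conjTranspose_self_eq_zero_iff,
      Matrix.conjTranspose_eq_transpose_of_trivial]
    linarith
  conv_lhs => rw [← Matrix.fromBlocks_toBlocks G, h21, h12, Matrix.transpose_zero]

/-- The matrix problem has a nondegenerate minimizer, whose gradient is block diagonal. -/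
theorem exists_minimizer_blockDiag {A B : Matrix (Fin d) (Fin d) ℝ} (hA : A.PosDef) (hB : B.PosDef)
    {W : BlockMat d} (hW : Wᵀ = W) {ε : ℝ} (hε : 0 < ε) :
    ∃ C P Q : Matrix (Fin d) (Fin d) ℝ, (covOfCross A B C).PosDef ∧
      W - ε • (covOfCross A B C)⁻¹ = Matrix.fromBlocks P 0 0 Q ∧
      ∀ C', (covOfCross A B C').PosDef →
        hsInner W (covOfCross A B C) - ε * Real.log (covOfCross A B C).det ≤
          hsInner W (covOfCross A B C') - ε * Real.log (covOfCross A B C').det := by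
  have hcont : Continuous fun C => expObjective W ε (covOfCross A B C) := by
    have h1 := continuous_covOfCross A B
    have h2 := (continuous_hsInner W).comp h1
    exact (Real.continuous_exp.comp (h2.neg.div_const ε)).mul h1.matrix_det
  have h0 := posDef_covOfCross_zero hA hB
  obtain ⟨C, hC, hmax⟩ := (isCompact_admissibleCross A B).exists_isMaxOn ⟨0, h0.posSemidef⟩
    hcont.continuousOn
  have hX : (covOfCross A B C).PosDef := by
    rw [Matrix.PosSemidef.posDef_iff_det_ne_zero hC]
    intro hdet
    -- A singular maximizer would have value `0`, below the positive value at `C = 0`.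
    have := hmax (show (0 : Matrix (Fin d) (Fin d) ℝ) ∈ admissibleCross A B from h0.posSemidef)
    simp only [expObjective, hdet, mul_zero, Set.mem_ofPred_eq] at this
    exact absurd this (not_le.2 (mul_pos (Real.exp_pos _) h0.det_pos))
  have hsymm : (covOfCross A B C)ᵀ = covOfCross A B C := hX.posSemidef.isHermitian
  refine ⟨C, _, _, hX, fromBlocks_offDiag_eq_zero (by
    rw [Matrix.transpose_sub, Matrix.transpose_smul, Matrix.transpose_nonsing_inv, hsymm, hW])
    fun E => ?_, fun C' hC' => ?_⟩
  · have := trace_eq_of_isMaxOn hX hmax E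
    rw [sub_mul, Matrix.trace_sub, Matrix.smul_mul, Matrix.trace_smul, ← this, smul_eq_mul,
      mul_div_cancel₀ _ hε.ne', hsInner, Matrix.fromBlocks_transpose]
    simp
  · have := hmax (show C' ∈ admissibleCross A B from hC'.posSemidef)
    have := Real.log_le_log (mul_pos (Real.exp_pos _) hC'.det_pos) this
    simp only [expObjective] at this
    rw [Real.log_mul (Real.exp_pos _).ne' hC'.det_pos.ne',
      Real.log_mul (Real.exp_pos _).ne' hX.det_pos.ne', Real.log_exp, Real.log_exp] at this
    have h := mul_le_mul_of_nonneg_left this hε.le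
    rw [mul_add, mul_add, mul_div_cancel₀ _ hε.ne', mul_div_cancel₀ _ hε.ne'] at h
    linarith

end MatrixProblem

open scoped RealInnerProductSpace

/-! ### Exponential tilting under changes of variables and scaling -/

theorem map_tilted_equiv {α β : Type*} [MeasurableSpace α] [MeasurableSpace β] (e : α ≃ᵐ β)
    (μ : Measure α) (f : α → ℝ) :
    (μ.tilted f).map e = (μ.map e).tilted (f ∘ e.symm) := by
  ext s hs
  rw [e.map_apply, tilted_apply' _ _ (e.measurable hs), tilted_apply' _ _ hs,
    e.restrict_map, lintegral_map_equiv, integral_map_equiv]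
  simp

theorem tilted_smul_measure {α : Type*} [MeasurableSpace α] {c : ℝ≥0∞} (hc : c ≠ 0)
    (hc' : c ≠ ∞) (μ : Measure α) (f : α → ℝ) : (c • μ).tilted f = μ.tilted f := by
  have hr : 0 < c.toReal := ENNReal.toReal_pos hc hc'
  rw [Measure.tilted, Measure.tilted, withDensity_smul_measure, integral_smul_measure,
    ← withDensity_smul' _ _ hc']
  congr 1
  ext x
  rw [Pi.smul_apply, smul_eq_mul, smul_eq_mul, mul_comm c.toReal, ← div_div,
    ENNReal.ofReal_div_of_pos hr, ENNReal.ofReal_toReal hc', ENNReal.mul_div_cancel hc hc']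

/-! ### The Lebesgue density of the standard Gaussian -/

section Std

variable {E : Type*} [NormedAddCommGroup E] [InnerProductSpace ℝ E] [FiniteDimensional ℝ E]
  [MeasurableSpace E] [BorelSpace E]

theorem integrable_exp_neg_half_sq_norm :
    Integrable (fun x : E => Real.exp (-(1 / 2) * ‖x‖ ^ 2)) := by
  have h := (GaussianFourier.integrable_cexp_neg_mul_sq_norm_add (V := E) (b := ((1 / 2 : ℝ) : ℂ))
    (by simp) 0 0).norm
  refine h.congr (.of_forall fun x => ?_)
  simp only [zero_mul, add_zero]
  norm_cast
  simp

theorem stdGaussian_eq_tilted :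
    stdGaussian E = (volume : Measure E).tilted (fun x => -(1 / 2) * ‖x‖ ^ 2) := by
  have := isProbabilityMeasure_tilted (integrable_exp_neg_half_sq_norm (E := E))
  apply Measure.ext_of_charFun
  ext t
  rw [charFun_stdGaussian, charFun_apply, integral_tilted,
    GaussianFourier.integral_rexp_neg_mul_sq_norm (by norm_num : (0 : ℝ) < 1 / 2)]
  set Z : ℝ := (Real.pi / (1 / 2)) ^ (Module.finrank ℝ E / 2 : ℝ) with hZ
  have hZ0 : Z ≠ 0 := by positivity
  have hZc : (Z : ℂ) = (Real.pi / ((1 / 2 : ℝ) : ℂ)) ^ (Module.finrank ℝ E / 2 : ℂ) := by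
    rw [hZ, Complex.ofReal_cpow (by positivity)]
    push_cast
    rfl
  have h := GaussianFourier.integral_cexp_neg_mul_sq_norm_add (V := E) (b := ((1 / 2 : ℝ) : ℂ))
    (by simp) Complex.I t
  rw [← hZc] at h
  have h2 : ∀ x : E, (Real.exp (-(1 / 2) * ‖x‖ ^ 2) / Z) • Complex.exp (⟪x, t⟫ * Complex.I)
      = (Z : ℂ)⁻¹ * Complex.exp (-((1 / 2 : ℝ) : ℂ) * ‖x‖ ^ 2 + Complex.I * ⟪t, x⟫) := by
    intro x
    rw [Complex.real_smul, Complex.exp_add, real_inner_comm, mul_comm Complex.I]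
    push_cast
    ring
  simp_rw [h2]
  rw [integral_const_mul, h, inv_mul_cancel_left₀ (Complex.ofReal_ne_zero.2 hZ0)]
  congr 1
  rw [Complex.I_sq]
  push_cast
  ring

end Std

/-! ### Densities of nondegenerate Gaussians -/

section Density

variable {ι : Type*} [Fintype ι] [DecidableEq ι]

/-- The quadratic form `x ↦ ⟨x, M x⟩`. -/
noncomputable def quadForm (M : Matrix ι ι ℝ) (x : ι → ℝ) : ℝ := x ⬝ᵥ M *ᵥ x

-- Push the standard Gaussian forward by the symmetric square root `R` of `X`. The Jacobian `det R =
-- √(det X)` disappears from the tilted measure, whose normalization absorbs constants, but remains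
-- in the normalizing integral.
open scoped MatrixOrder in
theorem multivariateGaussian_eq_tilted_volume {X : Matrix ι ι ℝ} (hX : X.PosDef) :
    Integrable (fun x : EuclideanSpace ℝ ι => Real.exp (-(1 / 2) * quadForm X⁻¹ x.ofLp)) ∧
    multivariateGaussian 0 X =
      (volume : Measure (EuclideanSpace ℝ ι)).tilted (fun x => -(1 / 2) * quadForm X⁻¹ x.ofLp) ∧
    ∫ x : EuclideanSpace ℝ ι, Real.exp (-(1 / 2) * quadForm X⁻¹ x.ofLp) =
      √X.det * ∫ x : EuclideanSpace ℝ ι, Real.exp (-(1 / 2) * ‖x‖ ^ 2) := by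
  set R := CFC.sqrt X with hR
  have hRR : R * R = X := CFC.sqrt_mul_sqrt_self X hX.posSemidef.nonneg
  have hdetR : R.det = √X.det := by
    rw [hR, hX.posSemidef.det_sqrt, RCLike.sqrt_of_nonneg hX.det_pos.le]; simp
  have hdpos : 0 < R.det := hdetR ▸ Real.sqrt_pos.2 hX.det_pos
  have hRu : IsUnit R.det := hdpos.ne'.isUnit
  have hRsymm : Rᵀ = R := by
    have h : R.PosSemidef := Matrix.nonneg_iff_posSemidef.1 (CFC.sqrt_nonneg X)
    exact h.isHermitian
  let T : EuclideanSpace ℝ ι →L[ℝ] EuclideanSpace ℝ ι := Matrix.toEuclideanCLM (𝕜 := ℝ) R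
  have hTdet : LinearMap.det (T : EuclideanSpace ℝ ι →ₗ[ℝ] EuclideanSpace ℝ ι) = R.det := by
    rw [Matrix.coe_toEuclideanCLM_eq_toEuclideanLin, Matrix.toEuclideanLin, Matrix.toLpLin_eq_toLin,
      LinearMap.det_toLin]
  let e : EuclideanSpace ℝ ι ≃ᵐ EuclideanSpace ℝ ι :=
    (LinearMap.equivOfDetNeZero (T : EuclideanSpace ℝ ι →ₗ[ℝ] EuclideanSpace ℝ ι)
      (hTdet ▸ hdpos.ne')).toContinuousLinearEquiv.toHomeomorph.toMeasurableEquiv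
  have he : ∀ x, e x = T x := fun x => rfl
  have hquad : ∀ x : EuclideanSpace ℝ ι, quadForm X⁻¹ (e x).ofLp = ‖x‖ ^ 2 := by
    intro x
    rw [he, quadForm, Matrix.ofLp_toEuclideanCLM, ← hRR, Matrix.mul_inv_rev, Matrix.mulVec_mulVec,
      Matrix.mul_assoc, Matrix.nonsing_inv_mul _ hRu, Matrix.mul_one, Matrix.dotProduct_mulVec,
      Matrix.vecMul_mulVec, hRsymm, Matrix.mul_nonsing_inv _ hRu, Matrix.vecMul_one,
      EuclideanSpace.real_norm_sq_eq]
    simp [dotProduct, sq]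
  have hquad' : ∀ x : EuclideanSpace ℝ ι, ‖e.symm x‖ ^ 2 = quadForm X⁻¹ x.ofLp := by
    intro x
    rw [← hquad, e.apply_symm_apply]
  have hvol : (volume : Measure (EuclideanSpace ℝ ι)).map e =
      ENNReal.ofReal (√X.det)⁻¹ • volume := by
    have := Measure.map_linearMap_addHaar_eq_smul_addHaar
      (volume : Measure (EuclideanSpace ℝ ι)) (hTdet ▸ hdpos.ne')
    rw [hTdet, abs_of_pos (inv_pos.2 hdpos), hdetR] at this
    exact this
  have hc : (0 : ℝ) < (√X.det)⁻¹ := hdetR ▸ inv_pos.2 hdpos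
  refine ⟨?_, ?_, ?_⟩
  · have h := integrable_exp_neg_half_sq_norm (E := EuclideanSpace ℝ ι)
    simp_rw [← hquad] at h
    have h2 := (integrable_map_equiv e
      (fun x => Real.exp (-(1 / 2) * quadForm X⁻¹ x.ofLp)) (μ := volume)).2 h
    rw [hvol] at h2
    exact (integrable_smul_measure (by simpa using hc) (by simp)).1 h2
  · have h : multivariateGaussian 0 X = (stdGaussian (EuclideanSpace ℝ ι)).map e := by
      rw [multivariateGaussian]
      congr 1
      ext1 x
      rw [zero_add, he]
    rw [h, stdGaussian_eq_tilted, map_tilted_equiv, hvol,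
      tilted_smul_measure (by simpa using hc) (by simp)]
    simp only [Function.comp_def, hquad']
  · simp_rw [← hquad]
    rw [← integral_map_equiv e (fun x => Real.exp (-(1 / 2) * quadForm X⁻¹ x.ofLp)), hvol,
      integral_smul_measure, ENNReal.toReal_ofReal hc.le, smul_eq_mul, ← hdetR,
      mul_inv_cancel_left₀ hdpos.ne']

/-- Successive tilts add their exponents. In the ratio of normalizing integrals the standard
Gaussian one cancels, leaving `√(det X / det S)`. -/
theorem multivariateGaussian_eq_tilted {X S : Matrix ι ι ℝ} (hX : X.PosDef) (hS : S.PosDef) :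
    Integrable (fun x => Real.exp (1 / 2 * quadForm (S⁻¹ - X⁻¹) x.ofLp))
      (multivariateGaussian 0 S) ∧
    multivariateGaussian 0 X =
      (multivariateGaussian 0 S).tilted (fun x => 1 / 2 * quadForm (S⁻¹ - X⁻¹) x.ofLp) ∧
    Real.log (∫ x, Real.exp (1 / 2 * quadForm (S⁻¹ - X⁻¹) x.ofLp) ∂multivariateGaussian 0 S) =
      1 / 2 * (Real.log X.det - Real.log S.det) := by
  obtain ⟨hXi, hXt, hXn⟩ := multivariateGaussian_eq_tilted_volume hX
  obtain ⟨hSi, hSt, hSn⟩ := multivariateGaussian_eq_tilted_volume hS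
  have hsum : ((fun x : EuclideanSpace ℝ ι => -(1 / 2) * quadForm S⁻¹ x.ofLp) +
      fun x => 1 / 2 * quadForm (S⁻¹ - X⁻¹) x.ofLp) =
      fun x => -(1 / 2) * quadForm X⁻¹ x.ofLp := by
    ext x
    simp only [Pi.add_apply, quadForm, Matrix.sub_mulVec, dotProduct_sub]
    ring
  refine ⟨?_, ?_, ?_⟩
  · rw [hSt, integrable_tilted_iff hSi]
    simp_rw [smul_eq_mul, ← Real.exp_add]
    exact hXi.congr (.of_forall fun x => congrArg Real.exp (congrFun hsum x).symm)
  · rw [hXt, hSt, tilted_tilted hSi, hsum]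
  · have hZ : (0 : ℝ) < ∫ x : EuclideanSpace ℝ ι, Real.exp (-(1 / 2) * ‖x‖ ^ 2) :=
      integral_exp_pos integrable_exp_neg_half_sq_norm
    have hXs := Real.sqrt_pos.2 hX.det_pos
    have hSs := Real.sqrt_pos.2 hS.det_pos
    rw [hSt, integral_exp_tilted, hsum, hSn, hXn, mul_div_mul_right _ _ hZ.ne',
      Real.log_div hXs.ne' hSs.ne', Real.log_sqrt hX.det_pos.le, Real.log_sqrt hS.det_pos.le]
    ring

end Density

/-! ### Gaussian measures on the product and their marginals -/

section Joint

variable {d : ℕ}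

/-- Concatenation of the coordinates of a pair of vectors. -/
noncomputable def concat (z : Rd d × Rd d) : Fin d ⊕ Fin d → ℝ := Sum.elim z.1.ofLp z.2.ofLp

theorem ofLp_eq_concat_sumEquivProd (x : EuclideanSpace ℝ (Fin d ⊕ Fin d)) :
    x.ofLp = concat (EuclideanSpace.sumEquivProd (𝕜 := ℝ) (ι := Fin d) (κ := Fin d) x) := by
  ext i
  cases i <;> rfl

theorem measurable_sumEquivProd : Measurable
    (EuclideanSpace.sumEquivProd (𝕜 := ℝ) (ι := Fin d) (κ := Fin d)) :=
  (EuclideanSpace.sumEquivProd (𝕜 := ℝ) (ι := Fin d) (κ := Fin d)).continuous.measurable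

instance isProbabilityMeasure_jointGaussian (S : BlockMat d) :
    IsProbabilityMeasure (jointGaussian S) :=
  Measure.isProbabilityMeasure_map measurable_sumEquivProd.aemeasurable

instance isProbabilityMeasure_gaussian (A : Matrix (Fin d) (Fin d) ℝ) :
    IsProbabilityMeasure (gaussian A) :=
  inferInstanceAs (IsProbabilityMeasure (multivariateGaussian 0 A))

theorem jointGaussian_eq_tilted {X S : BlockMat d} (hX : X.PosDef) (hS : S.PosDef) :
    Integrable (fun z => Real.exp (1 / 2 * quadForm (S⁻¹ - X⁻¹) (concat z))) (jointGaussian S) ∧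
    jointGaussian X =
      (jointGaussian S).tilted (fun z => 1 / 2 * quadForm (S⁻¹ - X⁻¹) (concat z)) ∧
    Real.log (∫ z, Real.exp (1 / 2 * quadForm (S⁻¹ - X⁻¹) (concat z)) ∂jointGaussian S) =
      1 / 2 * (Real.log X.det - Real.log S.det) := by
  obtain ⟨h1, h2, h3⟩ := multivariateGaussian_eq_tilted hX hS
  let e : EuclideanSpace ℝ (Fin d ⊕ Fin d) ≃ᵐ Rd d × Rd d :=
    (EuclideanSpace.sumEquivProd (𝕜 := ℝ) (ι := Fin d) (κ := Fin d)).toHomeomorph.toMeasurableEquiv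
  have he (S : BlockMat d) : jointGaussian S = (multivariateGaussian 0 S).map e := rfl
  have hc (x) : WithLp.ofLp x = concat (e x) := ofLp_eq_concat_sumEquivProd x
  simp_rw [hc] at h1 h2 h3
  refine ⟨?_, ?_, ?_⟩
  · rw [he, integrable_map_equiv]
    exact h1
  · rw [he, h2, map_tilted_equiv, he]
    congr 1
  · rw [he, integral_map_equiv]
    exact h3

theorem jointGaussian_map_fst {A B C : Matrix (Fin d) (Fin d) ℝ} (hA : A.PosSemidef)
    (hX : (covOfCross A B C).PosSemidef) :
    (jointGaussian (covOfCross A B C)).map Prod.fst = gaussian A := by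
  have : IsProbabilityMeasure ((jointGaussian (covOfCross A B C)).map Prod.fst) :=
    Measure.isProbabilityMeasure_map measurable_fst.aemeasurable
  apply Measure.ext_of_charFun
  ext t
  -- The marginal's characteristic function at `t` is the joint one at `(t, 0)`.
  have h := charFun_multivariateGaussian (μ := 0) hX (WithLp.toLp 2 (Sum.elim t.ofLp 0))
  rw [gaussian, charFun_multivariateGaussian hA]
  rw [charFun_apply] at h ⊢
  rw [jointGaussian, integral_map (by fun_prop) (by fun_prop),
    integral_map measurable_sumEquivProd.aemeasurable (by fun_prop)]
  convert! h using 1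
  · congr 1
    ext x
    simp [PiLp.inner_apply]
  · simp [covOfCross, Matrix.fromBlocks_mulVec]

theorem jointGaussian_map_snd {A B C : Matrix (Fin d) (Fin d) ℝ} (hB : B.PosSemidef)
    (hX : (covOfCross A B C).PosSemidef) :
    (jointGaussian (covOfCross A B C)).map Prod.snd = gaussian B := by
  have : IsProbabilityMeasure ((jointGaussian (covOfCross A B C)).map Prod.snd) :=
    Measure.isProbabilityMeasure_map measurable_snd.aemeasurable
  apply Measure.ext_of_charFun
  ext t
  have h := charFun_multivariateGaussian (μ := 0) hX (WithLp.toLp 2 (Sum.elim 0 t.ofLp))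
  rw [gaussian, charFun_multivariateGaussian hB]
  rw [charFun_apply] at h ⊢
  rw [jointGaussian, integral_map (by fun_prop) (by fun_prop),
    integral_map measurable_sumEquivProd.aemeasurable (by fun_prop)]
  convert! h using 1
  · congr 1
    ext x
    simp [PiLp.inner_apply]
  · simp [covOfCross, Matrix.fromBlocks_mulVec]

theorem memLp_eval_gaussian (A : Matrix (Fin d) (Fin d) ℝ) (i : Fin d) :
    MemLp (fun x : Rd d => x i) 2 (gaussian A) := by
  have h : MemLp id 2 (multivariateGaussian 0 A) := IsGaussian.memLp_two_id
  exact (EuclideanSpace.proj (𝕜 := ℝ) i).comp_memLp' h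

theorem integral_mul_gaussian {A : Matrix (Fin d) (Fin d) ℝ} (hA : A.PosSemidef) (i j : Fin d) :
    ∫ x, x i * x j ∂gaussian A = A i j := by
  have hmean (i : Fin d) : ∫ x, x i ∂gaussian A = 0 := by
    have h := (EuclideanSpace.proj (𝕜 := ℝ) i).integral_comp_comm
      (IsGaussian.integrable_id (μ := multivariateGaussian 0 A))
    simpa [gaussian] using h
  have h := covariance_eq_sub (memLp_eval_gaussian A i) (memLp_eval_gaussian A j)
  rw [hmean, zero_mul, sub_zero] at h
  rw [← covariance_eval_multivariateGaussian (μ := 0) hA i j]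
  exact h.symm

theorem quadForm_eq_sum {ι : Type*} [Fintype ι] [DecidableEq ι] (M : Matrix ι ι ℝ) (x : ι → ℝ) :
    quadForm M x = ∑ i, ∑ j, M i j * (x i * x j) := by
  simp only [quadForm, dotProduct, Matrix.mulVec, Finset.mul_sum]
  exact Finset.sum_congr rfl fun i _ => Finset.sum_congr rfl fun j _ => by ring

/-! ### Second moments of arbitrary couplings -/

section Coupling

variable {A B : Matrix (Fin d) (Fin d) ℝ} {π : Measure (Rd d × Rd d)}

theorem memLp_concat (hπ : π ∈ couplings (gaussian A) (gaussian B)) (i : Fin d ⊕ Fin d) :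
    MemLp (fun z => concat z i) 2 π := by
  cases i with
  | inl i =>
    have h := memLp_eval_gaussian A i
    rw [← hπ.1] at h
    exact h.comp_of_map measurable_fst.aemeasurable
  | inr i =>
    have h := memLp_eval_gaussian B i
    rw [← hπ.2] at h
    exact h.comp_of_map measurable_snd.aemeasurable

theorem integrable_mul_concat (hπ : π ∈ couplings (gaussian A) (gaussian B))
    (i j : Fin d ⊕ Fin d) : Integrable (fun z => concat z i * concat z j) π :=
  (memLp_concat hπ i).integrable_mul (memLp_concat hπ j)

theorem integrable_quadForm (hπ : π ∈ couplings (gaussian A) (gaussian B)) (M : BlockMat d) :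
    Integrable (fun z => quadForm M (concat z)) π := by
  simp_rw [quadForm_eq_sum]
  exact integrable_finsetSum _ fun i _ => integrable_finsetSum _ fun j _ =>
    (integrable_mul_concat hπ i j).const_mul _

theorem integral_quadForm (hπ : π ∈ couplings (gaussian A) (gaussian B)) (M : BlockMat d) :
    ∫ z, quadForm M (concat z) ∂π = ∑ i, ∑ j, M i j * ∫ z, concat z i * concat z j ∂π := by
  simp_rw [quadForm_eq_sum]
  refine (integral_finsetSum _ fun i _ => integrable_finsetSum _ fun j _ =>
    (integrable_mul_concat hπ i j).const_mul _).trans (Finset.sum_congr rfl fun i _ => ?_)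
  exact (integral_finsetSum _ fun j _ => (integrable_mul_concat hπ i j).const_mul _).trans
    (Finset.sum_congr rfl fun j _ => integral_const_mul _ _)

/-- A block-diagonal form sees only the marginal second moments, so `C` is arbitrary and unrelated
to `π`. -/
theorem integral_quadForm_blockDiag (hA : A.PosSemidef) (hB : B.PosSemidef)
    (hπ : π ∈ couplings (gaussian A) (gaussian B)) (P Q C : Matrix (Fin d) (Fin d) ℝ) :
    ∫ z, quadForm (Matrix.fromBlocks P 0 0 Q) (concat z) ∂π =
      hsInner (Matrix.fromBlocks P 0 0 Q) (covOfCross A B C) := by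
  have h1 (i j : Fin d) : ∫ z, concat z (Sum.inl i) * concat z (Sum.inl j) ∂π = A i j := by
    rw [← integral_mul_gaussian hA, ← hπ.1, integral_map measurable_fst.aemeasurable (by fun_prop)]
    rfl
  have h2 (i j : Fin d) : ∫ z, concat z (Sum.inr i) * concat z (Sum.inr j) ∂π = B i j := by
    rw [← integral_mul_gaussian hB, ← hπ.2, integral_map measurable_snd.aemeasurable (by fun_prop)]
    rfl
  rw [integral_quadForm hπ]
  simp [h1, h2, hsInner, covOfCross, Matrix.trace, Matrix.mul_apply, Fintype.sum_sum_type]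

end Coupling

/-! ### Transport cost and relative entropy -/

theorem sq_norm_sub_eq_quadForm (z : Rd d × Rd d) :
    ‖z.1 - z.2‖ ^ 2 = quadForm (otMatrix d) (concat z) := by
  rw [EuclideanSpace.real_norm_sq_eq]
  simp only [quadForm, otMatrix, concat, Matrix.fromBlocks_mulVec, dotProduct, Fintype.sum_sum_type,
    ← Finset.sum_add_distrib]
  refine Finset.sum_congr rfl fun i _ => ?_
  simp [Matrix.neg_mulVec]
  ring

theorem isProbabilityMeasure_of_mem_couplings {A B : Matrix (Fin d) (Fin d) ℝ}
    {π : Measure (Rd d × Rd d)} (hπ : π ∈ couplings (gaussian A) (gaussian B)) :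
    IsProbabilityMeasure π := by
  have h : IsProbabilityMeasure (π.map Prod.fst) := hπ.1 ▸ isProbabilityMeasure_gaussian A
  exact (Measure.isProbabilityMeasure_map_iff measurable_fst.aemeasurable).1 h

theorem jointGaussian_mem_couplings {A B C : Matrix (Fin d) (Fin d) ℝ} (hA : A.PosSemidef)
    (hB : B.PosSemidef) (hX : (covOfCross A B C).PosSemidef) :
    jointGaussian (covOfCross A B C) ∈ couplings (gaussian A) (gaussian B) :=
  ⟨jointGaussian_map_fst hA hX, jointGaussian_map_snd hB hX⟩

/-- The Gibbs decomposition of the relative entropy with respect to a Gaussian reference. -/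
theorem klDiv_jointGaussian_change {A B : Matrix (Fin d) (Fin d) ℝ} {X S : BlockMat d}
    (hX : X.PosDef) (hS : S.PosDef) {π : Measure (Rd d × Rd d)}
    (hπ : π ∈ couplings (gaussian A) (gaussian B)) (hfin : klDiv π (jointGaussian S) ≠ ∞) :
    (klDiv π (jointGaussian S)).toReal = (klDiv π (jointGaussian X)).toReal +
      1 / 2 * ∫ z, quadForm (S⁻¹ - X⁻¹) (concat z) ∂π -
      1 / 2 * (Real.log X.det - Real.log S.det) := by
  have := isProbabilityMeasure_of_mem_couplings hπ
  obtain ⟨h1, h2, h3⟩ := jointGaussian_eq_tilted hX hS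
  obtain ⟨hac, hint⟩ := klDiv_ne_top_iff.1 hfin
  have hac' : π ≪ jointGaussian X := h2 ▸ hac.trans (absolutelyContinuous_tilted h1)
  -- All masses equal one, so each divergence is the plain integral of the log-likelihood ratio.
  rw [toReal_klDiv_of_measure_eq hac (by simp), toReal_klDiv_of_measure_eq hac' (by simp), h2,
    integral_llr_tilted_right hac ((integrable_quadForm hπ _).const_mul _) h1 hint, h3,
    integral_const_mul]
  ring

/-- The log-density is a quadratic form minus a constant, integrable by the second-moment bounds. -/
theorem klDiv_jointGaussian_ne_top {A B C : Matrix (Fin d) (Fin d) ℝ} {S : BlockMat d}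
    (hA : A.PosSemidef) (hB : B.PosSemidef) (hX : (covOfCross A B C).PosDef) (hS : S.PosDef) :
    klDiv (jointGaussian (covOfCross A B C)) (jointGaussian S) ≠ ∞ := by
  set X := covOfCross A B C with hXdef
  obtain ⟨h1, h2, -⟩ := jointGaussian_eq_tilted hX hS
  have hac : jointGaussian X ≪ jointGaussian S := h2 ▸ tilted_absolutelyContinuous _ _
  have hq := (integrable_quadForm
    (jointGaussian_mem_couplings hA hB hX.posSemidef) (S⁻¹ - X⁻¹)).const_mul (1 / 2)
  refine klDiv_ne_top hac ?_
  have hae := hac.ae_le (log_rnDeriv_tilted_left_self h1)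
  rw [← h2] at hae
  exact (integrable_congr hae).2 (hq.sub (integrable_const _))

theorem hsInner_inv_self {X : BlockMat d} (hX : X.PosDef) : hsInner X⁻¹ X = 2 * d := by
  have hsymm : Xᵀ = X := hX.posSemidef.isHermitian
  rw [hsInner, hsymm, Matrix.nonsing_inv_mul _ ((Matrix.isUnit_iff_isUnit_det _).1 hX.isUnit)]
  simp [two_mul]

theorem quadForm_otMatrix_nonneg (z : Rd d × Rd d) : 0 ≤ quadForm (otMatrix d) (concat z) := by
  rw [← sq_norm_sub_eq_quadForm]
  positivity

theorem transportObjective_eq {A B : Matrix (Fin d) (Fin d) ℝ} (S : BlockMat d) {ε : ℝ}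
    (hε : 0 < ε) {π : Measure (Rd d × Rd d)} (hπ : π ∈ couplings (gaussian A) (gaussian B))
    (hfin : klDiv π (jointGaussian S) ≠ ∞) :
    transportObjective S ε π = ENNReal.ofReal (∫ z, quadForm (otMatrix d) (concat z) ∂π +
      2 * ε * (klDiv π (jointGaussian S)).toReal) := by
  rw [ENNReal.ofReal_add (integral_nonneg quadForm_otMatrix_nonneg) (by positivity),
    ENNReal.ofReal_mul (by positivity), ENNReal.ofReal_toReal hfin, transportObjective,
    ofReal_integral_eq_lintegral_ofReal (integrable_quadForm hπ _)
      (.of_forall quadForm_otMatrix_nonneg)]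
  simp_rw [sq_norm_sub_eq_quadForm]

/-- If the gradient of the matrix objective at `C` is block diagonal, the transport objective is
its value at the Gaussian coupling with cross-covariance `C` plus a relative entropy. -/
theorem cost_add_klDiv_eq {A B C P Q : Matrix (Fin d) (Fin d) ℝ} {S : BlockMat d}
    (hA : A.PosSemidef) (hB : B.PosSemidef) (hX : (covOfCross A B C).PosDef) (hS : S.PosDef)
    {ε : ℝ}
    (hPQ : otMatrix d + ε • S⁻¹ - ε • (covOfCross A B C)⁻¹ = Matrix.fromBlocks P 0 0 Q)
    {π : Measure (Rd d × Rd d)} (hπ : π ∈ couplings (gaussian A) (gaussian B))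
    (hfin : klDiv π (jointGaussian S) ≠ ∞) :
    ∫ z, quadForm (otMatrix d) (concat z) ∂π + 2 * ε * (klDiv π (jointGaussian S)).toReal =
      hsInner (otMatrix d + ε • S⁻¹) (covOfCross A B C) - ε * Real.log (covOfCross A B C).det
        + ε * Real.log S.det - 2 * ε * d +
      2 * ε * (klDiv π (jointGaussian (covOfCross A B C))).toReal := by
  set X := covOfCross A B C with hXdef
  rw [klDiv_jointGaussian_change hX hS hπ hfin]
  have hlin : hsInner (Matrix.fromBlocks P 0 0 Q) X =
      hsInner (otMatrix d + ε • S⁻¹) X - ε * (2 * d) := by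
    rw [← hPQ, ← hsInner_inv_self hX]
    simp [hsInner, sub_mul]
  -- The factor `2 ε` cancels the `1 / 2` in the Gaussian exponent, so cost and entropy correction
  -- combine into the block-diagonal form.
  have hint : ∫ z, quadForm (Matrix.fromBlocks P 0 0 Q) (concat z) ∂π =
      ∫ z, quadForm (otMatrix d) (concat z) ∂π +
        ε * ∫ z, quadForm (S⁻¹ - X⁻¹) (concat z) ∂π := by
    rw [← integral_const_mul, ← integral_add (integrable_quadForm hπ _)
      ((integrable_quadForm hπ _).const_mul _), ← hPQ]
    congr 1
    ext z
    simp only [quadForm, Matrix.sub_mulVec, Matrix.add_mulVec, Matrix.smul_mulVec, dotProduct_sub,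
      dotProduct_add, dotProduct_smul, smul_eq_mul]
    ring
  rw [integral_quadForm_blockDiag hA hB hπ P Q C, hlin] at hint
  linarith

theorem matrixObjective_of_posDef {A B C : Matrix (Fin d) (Fin d) ℝ} (S : BlockMat d) (ε : ℝ)
    (hX : (covOfCross A B C).PosDef) :
    matrixObjective A B S ε C = ((hsInner (otMatrix d + ε • S⁻¹) (covOfCross A B C) -
      ε * Real.log (covOfCross A B C).det : ℝ) : EReal) := by
  rw [matrixObjective, negLogDet, if_pos hX, ← EReal.coe_mul, ← EReal.coe_add]
  congr 1
  ring

theorem matrixObjective_of_not_posDef {A B C : Matrix (Fin d) (Fin d) ℝ} (S : BlockMat d) {ε : ℝ}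
    (hε : 0 < ε) (hX : ¬ (covOfCross A B C).PosDef) : matrixObjective A B S ε C = ⊤ := by
  rw [matrixObjective, negLogDet, if_neg hX, EReal.coe_mul_top_of_pos hε, EReal.coe_add_top]

theorem transpose_otMatrix_add {S : BlockMat d} (hS : S.PosDef) (ε : ℝ) :
    (otMatrix d + ε • S⁻¹)ᵀ = otMatrix d + ε • S⁻¹ := by
  have hsymm : Sᵀ = S := hS.posSemidef.isHermitian
  rw [Matrix.transpose_add, Matrix.transpose_smul, Matrix.transpose_nonsing_inv, hsymm, otMatrix,
    Matrix.fromBlocks_transpose]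
  simp

end Joint

end GaussianEOT

/-! ### Equality of the two problems -/

open GaussianEOT in
theorem mainTheorem6 (d : ℕ) (A B : Matrix (Fin d) (Fin d) ℝ) (hA : A.PosDef) (hB : B.PosDef)
    (S : GaussianEOT.BlockMat d) (hS : S.PosDef) (ε : ℝ) (hε : 0 < ε) :
    IsLeast
      (GaussianEOT.transportObjective S ε ''
        GaussianEOT.couplings (GaussianEOT.gaussian A) (GaussianEOT.gaussian B))
      (GaussianEOT.entropicOT S ε (GaussianEOT.gaussian A) (GaussianEOT.gaussian B)) ∧
    ∃ m : ℝ,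
      IsLeast (GaussianEOT.matrixObjective A B S ε '' GaussianEOT.admissibleCross A B)
        (m : EReal) ∧
      ((GaussianEOT.entropicOT S ε (GaussianEOT.gaussian A) (GaussianEOT.gaussian B) : ℝ≥0∞) :
          EReal) =
        ((m + ε * Real.log S.det - 2 * ε * d : ℝ) : EReal) := by
  obtain ⟨C, P, Q, hX, hPQ, hmin⟩ :=
    exists_minimizer_blockDiag hA hB (transpose_otMatrix_add hS ε) hε
  set m := hsInner (otMatrix d + ε • S⁻¹) (covOfCross A B C) -
    ε * Real.log (covOfCross A B C).det with hm
  set V := m + ε * Real.log S.det - 2 * ε * d with hV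
  have hmem := jointGaussian_mem_couplings hA.posSemidef hB.posSemidef hX.posSemidef
  have hfin := klDiv_jointGaussian_ne_top hA.posSemidef hB.posSemidef hX hS
  have hobj {π : Measure (Rd d × Rd d)} (hπ : π ∈ couplings (gaussian A) (gaussian B))
      (h : klDiv π (jointGaussian S) ≠ ∞) := cost_add_klDiv_eq
    hA.posSemidef hB.posSemidef hX hS hPQ hπ h
  have hval : transportObjective S ε (jointGaussian (covOfCross A B C)) = ENNReal.ofReal V := by
    rw [transportObjective_eq S hε hmem hfin, hobj hmem hfin, klDiv_self,
      ENNReal.toReal_zero, mul_zero, add_zero]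
  -- `ENNReal.ofReal` truncates negative numbers, so the final equality in `EReal` needs this sign.
  -- It holds because `V` is a cost plus an entropy.
  have hV0 : 0 ≤ V := by
    have h := hobj hmem hfin
    rw [klDiv_self, ENNReal.toReal_zero, mul_zero, add_zero] at h
    rw [hV, hm, ← h]
    exact add_nonneg (integral_nonneg quadForm_otMatrix_nonneg) (by positivity)
  have hlow : ∀ π ∈ couplings (gaussian A) (gaussian B),
      ENNReal.ofReal V ≤ transportObjective S ε π := by
    intro π hπ
    by_cases h : klDiv π (jointGaussian S) = ∞
    · rw [transportObjective, h, ENNReal.mul_top (by simpa using hε)]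
      simp
    · rw [transportObjective_eq S hε hπ h, hobj hπ h]
      exact ENNReal.ofReal_le_ofReal (le_add_of_nonneg_right (by positivity))
  have hW : entropicOT S ε (gaussian A) (gaussian B) = ENNReal.ofReal V :=
    le_antisymm ((iInf₂_le _ hmem).trans hval.le) (le_iInf₂ hlow)
  rw [hW]
  refine ⟨⟨⟨_, hmem, hval⟩, ?_⟩, m, ⟨⟨C, hX.posSemidef, matrixObjective_of_posDef S ε hX⟩, ?_⟩, ?_⟩
  · rintro _ ⟨π, hπ, rfl⟩
    exact hlow π hπ
  · rintro _ ⟨C', -, rfl⟩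
    by_cases hC' : (covOfCross A B C').PosDef
    · rw [matrixObjective_of_posDef S ε hC']
      exact EReal.coe_le_coe_iff.2 (hmin C' hC')
    · rw [matrixObjective_of_not_posDef S hε hC']
      exact le_top
  · rw [EReal.coe_ennreal_ofReal, max_eq_left hV0]
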